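/- Let $d\ge 2$, and let a formation consist of leaders $\mathcal V_\ell=\{1,\dots,n_\ell\}$ with $n_\ell\ge 2$ and followers $\mathcal V_f=\{n_\ell+1,\dots,n\}$ with positions $p_i(t)\in\mathbb R^d$ and velocities $v_i=\dot p_i$. Let $\mathcal G=(\mathcal V,\mathcal E)$ be a fixed directed graph on $\mathcal V=\mathcal V_\ell\cup\mathcal V_f$ in which the edges between followers are bidirectional, let $\mathcal N_i=\{j:(i,j)\in\mathcal E\}$, and for $(i,j)\in\mathcal E$ let $g^*_{ij}\in\mathbb R^d$ be a constant unit vector (the desired bearing). Put $P_{g^*_{ij}}=I_d-g^*_{ij}(g^*_{ij})^T$ and $K_i=\sum_{j\in\mathcal N_i}P_{g^*_{ij}}$. The bearing Laplacian $\mathcal L\in\mathbb R^{dn\times dn}$ has the $d\times d$ blocks $[\mathcal L]_{ii}=K_i$, $[\mathcal L]_{ij}=-P_{g^*_{ij}}$ if $i\ne j$ and $(i,j)\in\mathcal E$, and $[\mathcal L]_{ij}=0$ otherwise; assume that its follower–follower block $\mathcal L_{ff}$ is nonsingular. The motion of the leaders on $[0,\infty)$ is given; their velocities are continuous and piecewise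 continuously differentiable (with finitely many break points in every bounded interval, and one-sided limits of the derivative there), and otherwise arbitrary, except that there is a target formation: a $p^*(t)=(p^*_i(t))_{i\in\mathcal V}$ with $(p_j^*(t)-p_i^*(t))/\|p_j^*(t)-p_i^*(t)\|=g^*_{ij}$ for all $(i,j)\in\mathcal E$ and $p_i^*(t)=p_i(t)$ for all $i\in\mathcal V_\ell$, for all $t\ge 0$. Let $k_p,k_v,\beta>0$, and let $\mathrm{sat}$ be either $\mathrm{sat}(x)=\mathrm{sign}(x)\min\{|x|,\beta\}$ or $\mathrm{sat}(x)=\beta\tanh(x)$, applied componentwise to vectors. Let the followers obey $\dot p_i=v_i$, with $v_i$ continuous, and, except at a set of times that has finitely many elements in every bounded interval, $\dot v_i=u_i$ with $$u_i=K_i^{-1}\,\mathrm{sat}\Big\{-\sum_{j\in\mathcal N_i}P_{g^*_{ij}}\big[k_p(p_i-p_j)+k_v(v_i-v_j)\big]\Big\}+K_i^{-1}\sum_{j\in\mathcal N_i}P_{g^*_{ij}}\dot v_j,\qquad i\in\mathcal V_f .$$ Then $p_f^*=(p_i^*)_{i\in\mathcal V_f}$ is differentiable on $[0,\infty)$, and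 with $v_f^*=\dot p_f^*$ the tracking errors $\delta_p=p_f-p_f^*$ and $\delta_v=v_f-v_f^*$ globally and asymptotically converge to zero: for all initial positions and velocities of the followers the closed loop has a solution on $[0,\infty)$; for every solution, $\delta_p(t)\to 0$ and $\delta_v(t)\to 0$ as $t\to\infty$; and for every $\varepsilon>0$ there is an $\eta>0$ such that $\|\delta_p(0)\|<\eta$ and $\|\delta_v(0)\|<\eta$ imply $\|\delta_p(t)\|<\varepsilon$ and $\|\delta_v(t)\|<\varepsilon$ for all $t\ge 0$, for every solution. -/

import Mathlib

open Set Filter Topology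
open scoped Matrix

noncomputable section

namespace BearingFormation

/-- Euclidean space `ℝ^d`. -/
abbrev Pt (d : ℕ) : Type := EuclideanSpace ℝ (Fin d)

/-- The agents: `nl` leaders followed by `nf` followers. -/
abbrev Agent (nl nf : ℕ) : Type := Fin nl ⊕ Fin nf

/-- The matrix `A` applied to the vector `x`. -/
def act {d : ℕ} (A : Matrix (Fin d) (Fin d) ℝ) (x : Pt d) : Pt d :=
  WithLp.toLp 2 (A *ᵥ x.ofLp)

/-- `P_g = I - g gᵀ`. -/
def projMat {d : ℕ} (g : Pt d) : Matrix (Fin d) (Fin d) ℝ :=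
  1 - Matrix.vecMulVec g.ofLp g.ofLp

/-- The fixed data of the problem: the directed information-flow graph (an edge from `i` to `j`
means that `i` has access to the information of `j`), bidirectional between followers, and the
desired constant bearing (a unit vector) of every edge.  Values of `bearing` off the edges are
never used. -/
structure Setup (nl nf d : ℕ) where
  graph : Digraph (Agent nl nf)
  bidirectional : ∀ i j : Fin nf,
    graph.Adj (Sum.inr i) (Sum.inr j) → graph.Adj (Sum.inr j) (Sum.inr i)
  bearing : Agent nl nf → Agent nl nf → Pt d
  norm_bearing : ∀ i j, graph.Adj i j → ‖bearing i j‖ = 1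

variable {nl nf d : ℕ}

open Classical in
/-- The neighbours `N_i = {j : (i, j) ∈ E}`. -/
def Setup.nbrs (F : Setup nl nf d) (i : Agent nl nf) : Finset (Agent nl nf) :=
  Finset.univ.filter fun j => F.graph.Adj i j

/-- The projection `P_{g*_ij}` onto the orthogonal complement of the desired bearing. -/
def Setup.P (F : Setup nl nf d) (i j : Agent nl nf) : Matrix (Fin d) (Fin d) ℝ :=
  projMat (F.bearing i j)

/-- `K_i = ∑_{j ∈ N_i} P_{g*_ij}`. -/
def Setup.K (F : Setup nl nf d) (i : Agent nl nf) : Matrix (Fin d) (Fin d) ℝ :=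
  ∑ j ∈ F.nbrs i, F.P i j

open Classical in
/-- The `d × d` block of the bearing Laplacian in position `(i, j)`. -/
def Setup.lapBlock (F : Setup nl nf d) (i j : Agent nl nf) : Matrix (Fin d) (Fin d) ℝ :=
  if i = j then F.K i else if F.graph.Adj i j then -F.P i j else 0

/-- The bearing Laplacian, a `dn × dn` matrix. -/
def Setup.laplacian (F : Setup nl nf d) :
    Matrix (Agent nl nf × Fin d) (Agent nl nf × Fin d) ℝ :=
  Matrix.of fun a b => F.lapBlock a.1 b.1 a.2 b.2

/-- The follower-follower block `L_ff` of the bearing Laplacian. -/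
def Setup.Lff (F : Setup nl nf d) : Matrix (Fin nf × Fin d) (Fin nf × Fin d) ℝ :=
  F.laplacian.submatrix (fun a => (Sum.inr a.1, a.2)) (fun a => (Sum.inr a.1, a.2))

/-- A set of times with only finitely many elements in every bounded interval `[0, T]`. -/
def LocFinite (S : Set ℝ) : Prop := ∀ T : ℝ, (S ∩ Icc 0 T).Finite

/-- `f` is continuous and piecewise continuously differentiable on `[0, ∞)`: away from a locally
finite set of break points it is `C¹`, with one-sided derivatives at the break points that are
the one-sided limits of the derivative. -/
def PiecewiseC1 {E : Type*} [NormedAddCommGroup E] [NormedSpace ℝ E] (f : ℝ → E) : Prop :=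
  ContinuousOn f (Ici 0) ∧
  ∃ S : Set ℝ, LocFinite S ∧
    ∀ a b : ℝ, 0 ≤ a → a < b → Disjoint (Ioo a b) S → ContDiffOn ℝ 1 f (Icc a b)

/-- The motion of the leaders: `vl` is the velocity of `pl` on `[0, ∞)` and is piecewise
continuously differentiable. -/
structure IsLeaderMotion (pl vl : ℝ → Fin nl → Pt d) : Prop where
  velocity : ∀ t, 0 ≤ t → HasDerivWithinAt pl (vl t) (Ici 0) t
  piecewise : PiecewiseC1 vl

/-- `ps` is a target formation for the leader positions `pl`: at all times `t ≥ 0` it has the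
desired bearings, and its leaders are where the leaders are. -/
structure Setup.IsTarget (F : Setup nl nf d) (pl : ℝ → Fin nl → Pt d)
    (ps : ℝ → Agent nl nf → Pt d) : Prop where
  bearing : ∀ t, 0 ≤ t → ∀ i j, F.graph.Adj i j →
    (‖ps t j - ps t i‖)⁻¹ • (ps t j - ps t i) = F.bearing i j
  leader : ∀ t, 0 ≤ t → ∀ i, ps t (Sum.inl i) = pl t i

/-- The two saturation functions with bound `β`. -/
def IsSaturation (β : ℝ) (sat : ℝ → ℝ) : Prop :=
  (sat = fun x => Real.sign x * min |x| β) ∨ (sat = fun x => β * Real.tanh x)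

/-- Componentwise application of a scalar function to a vector. -/
def mapVec (sat : ℝ → ℝ) (x : Pt d) : Pt d :=
  WithLp.toLp 2 fun k => sat (x k)

/-- The saturated control law of follower `i`, as a function of the positions `p`, velocities `v`
and accelerations `a` of all agents. -/
def Setup.control (F : Setup nl nf d) (sat : ℝ → ℝ) (kp kv : ℝ)
    (p v a : Agent nl nf → Pt d) (i : Agent nl nf) : Pt d :=
  act (F.K i)⁻¹ (mapVec sat
      (-∑ j ∈ F.nbrs i, act (F.P i j) (kp • (p i - p j) + kv • (v i - v j))))
    + act (F.K i)⁻¹ (∑ j ∈ F.nbrs i, act (F.P i j) (a j))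

/-- The states of all agents at one time, from those of the leaders and of the followers. -/
def join (xl : Fin nl → Pt d) (xf : Fin nf → Pt d) : Agent nl nf → Pt d := Sum.elim xl xf

/-- `(pf, vf)` is a trajectory on `[0, ∞)` of the followers under the control law, for the given
motion of the leaders: `ṗ_f = v_f` always, `v_f` is continuous, and at all times outside a locally
finite set all agents have accelerations `a_j = v̇_j`, and `v̇_i = u_i` holds for every follower. The
accelerations `a_j` of neighbouring followers enter `u_i`, so the law is an implicit equation. -/
structure Setup.IsTrajectory (F : Setup nl nf d) (sat : ℝ → ℝ) (kp kv : ℝ)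
    (pl vl : ℝ → Fin nl → Pt d) (pf vf : ℝ → Fin nf → Pt d) : Prop where
  position : ∀ t, 0 ≤ t → HasDerivWithinAt pf (vf t) (Ici 0) t
  continuous : ContinuousOn vf (Ici 0)
  law : ∃ D : Set ℝ, LocFinite D ∧ ∀ t, 0 ≤ t → t ∉ D →
    ∃ (al : Fin nl → Pt d) (af : Fin nf → Pt d),
      HasDerivWithinAt vl al (Ici 0) t ∧ HasDerivWithinAt vf af (Ici 0) t ∧
      ∀ i : Fin nf, af i =
        F.control sat kp kv (join (pl t) (pf t)) (join (vl t) (vf t)) (join al af) (Sum.inr i)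

/-- The followers of a formation. -/
def followers (ps : ℝ → Agent nl nf → Pt d) : ℝ → Fin nf → Pt d :=
  fun t i => ps t (Sum.inr i)

/-- The position error `δ_p = p_f - p_f*`. -/
def posError (ps : ℝ → Agent nl nf → Pt d) (pf : ℝ → Fin nf → Pt d) (t : ℝ) : Fin nf → Pt d :=
  pf t - followers ps t

/-- The velocity error `δ_v = v_f - v_f*`, where `v_f*` is the derivative of `p_f*`. -/
def velError (ps : ℝ → Agent nl nf → Pt d) (vf : ℝ → Fin nf → Pt d) (t : ℝ) : Fin nf → Pt d :=
  vf t - derivWithin (followers ps) (Ici 0) t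

end BearingFormation

end

noncomputable section

/-! Multiplying the control law of follower `i` by `K_i` clears both inverses and makes the implicit
law explicit: row `i` of the bearing Laplacian, applied to the accelerations, is `sat` of minus
(`kp` times that row of the positions plus `kv` times that row of the velocities)
(`control_eq_iff`). A target formation is annihilated by the follower rows. As `L_ff` is
nonsingular, `p_f*` is therefore a fixed linear image of the leader positions, hence differentiable,
and the rows see only `y = L_ff δ_p` (`exists_error_coordinates`). The closed loop becomes `y'' =
-sat (kp y + kv y')` componentwise: independent scalar equations without leader terms.

For one such equation put `w = q'`, `s = kp q + kv w`. The energy `∫₀ˢ φ + kp w² / 2` has derivative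
`-kv φ(s)²`, so it bounds `s` and `w`, which gives stability (`saturated_stable`). Once `s` is
bounded, `φ` satisfies a sector condition on its range, and subtracting a small multiple of `s w`
turns the energy into a strict Lyapunov function (`tendsto_zero`). Solutions are global because the
right side is globally Lipschitz (`exists_global_solution`). -/

namespace BearingFormation

/-! ### Saturation functions: sector bounds and primitives -/

/-- An odd Lipschitz function that grows at least like `c x / (1 + x)` for `x ≥ 0`. -/
structure SaturationLike (φ : ℝ → ℝ) (c : ℝ) (K : NNReal) : Prop where
  pos : 0 < c
  odd : ∀ x, φ (-x) = -φ x
  lipschitz : LipschitzWith K φ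
  lower : ∀ x, 0 ≤ x → c * x / (1 + x) ≤ φ x

theorem sign_mul_min_eq_clamp {β : ℝ} (hβ : 0 < β) (x : ℝ) :
    Real.sign x * min |x| β = max (-β) (min x β) := by
  rcases lt_trichotomy x 0 with h | h | h
  · rw [Real.sign_of_neg h, abs_of_neg h, min_eq_left (by linarith : x ≤ β)]
    rcases le_total (-x) β with h1 | h1
    · rw [min_eq_left h1, max_eq_right (by linarith)]; ring
    · rw [min_eq_right h1, max_eq_left (by linarith)]; ring
  · subst h
    simp [hβ.le]
  · rw [Real.sign_of_pos h, abs_of_pos h, one_mul, max_eq_right]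
    have := le_min h.le hβ.le
    linarith

theorem saturationLike_clamp {β : ℝ} (hβ : 0 < β) :
    SaturationLike (fun x => Real.sign x * min |x| β) (min 1 β) 1 where
  pos := by positivity
  odd x := by simp only [Real.sign_neg, abs_neg]; ring
  lipschitz := by
    simp only [sign_mul_min_eq_clamp hβ]
    exact (LipschitzWith.id.min_const β).const_max (-β)
  lower x hx := by
    rcases hx.eq_or_lt with rfl | hx
    · simp
    · rw [Real.sign_of_pos hx, one_mul, abs_of_pos hx, div_le_iff₀ (by positivity)]
      have h1 := min_le_left 1 β
      have h2 := min_le_right 1 β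
      rcases le_total x β with h | h
      · rw [min_eq_left h]; nlinarith
      · rw [min_eq_right h]; nlinarith

theorem hasDerivAt_tanh (x : ℝ) : HasDerivAt Real.tanh (1 / Real.cosh x ^ 2) x := by
  have h := (Real.hasDerivAt_sinh x).div (Real.hasDerivAt_cosh x) (Real.cosh_pos x).ne'
  have e : Real.tanh = Real.sinh / Real.cosh := by
    ext y; simp [Real.tanh_eq_sinh_div_cosh]
  rw [e]
  exact h.congr_deriv (by rw [← Real.cosh_sq_sub_sinh_sq x]; ring)

theorem lipschitzWith_tanh : LipschitzWith 1 Real.tanh := by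
  refine lipschitzWith_of_nnnorm_deriv_le (fun x => (hasDerivAt_tanh x).differentiableAt) ?_
  intro x
  rw [(hasDerivAt_tanh x).deriv, ← NNReal.coe_le_coe, coe_nnnorm, Real.norm_eq_abs,
    abs_of_nonneg (by positivity), NNReal.coe_one, div_le_one (pow_pos (Real.cosh_pos x) 2)]
  exact one_le_pow₀ (Real.one_le_cosh x)

/-- After clearing denominators this is `1 + 2x ≤ exp (2x)`. -/
theorem div_one_add_le_tanh {x : ℝ} (hx : 0 ≤ x) : x / (1 + x) ≤ Real.tanh x := by
  rw [Real.tanh_eq_sinh_div_cosh, div_le_div_iff₀ (by positivity) (Real.cosh_pos x),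
    Real.sinh_eq, Real.cosh_eq]
  have h1 := Real.add_one_le_exp (2 * x)
  have h2 : Real.exp x = Real.exp (2 * x) * Real.exp (-x) := by
    rw [← Real.exp_add]; ring_nf
  have h3 := Real.exp_pos (-x)
  rw [h2]
  nlinarith [mul_le_mul_of_nonneg_right h1 h3.le]

theorem saturationLike_tanh {β : ℝ} (hβ : 0 < β) :
    SaturationLike (fun x => β * Real.tanh x) β (Real.toNNReal β) where
  pos := hβ
  odd x := by simp [Real.tanh_neg]
  lipschitz := by
    refine LipschitzWith.of_dist_le_mul fun x y => ?_
    have h := lipschitzWith_tanh.dist_le_mul x y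
    rw [Real.dist_eq] at h ⊢
    rw [← mul_sub, abs_mul, abs_of_pos hβ, Real.coe_toNNReal β hβ.le]
    gcongr
    simpa using h
  lower x hx := by
    rw [mul_div_assoc]
    exact mul_le_mul_of_nonneg_left (div_one_add_le_tanh hx) hβ.le

theorem IsSaturation.saturationLike {β : ℝ} (hβ : 0 < β) {sat : ℝ → ℝ}
    (h : IsSaturation β sat) : ∃ c K, SaturationLike sat c K := by
  rcases h with rfl | rfl
  · exact ⟨_, _, saturationLike_clamp hβ⟩
  · exact ⟨_, _, saturationLike_tanh hβ⟩

namespace SaturationLike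

variable {φ : ℝ → ℝ} {c : ℝ} {K : NNReal}

theorem map_zero (h : SaturationLike φ c K) : φ 0 = 0 := by
  have := h.odd 0
  rw [neg_zero] at this
  linarith

theorem abs_le (h : SaturationLike φ c K) (x : ℝ) : |φ x| ≤ K * |x| := by
  simpa [Real.dist_eq, h.map_zero] using h.lipschitz.dist_le_mul x 0

/-- On a bounded interval `φ` lies in a sector. -/
theorem sector (h : SaturationLike φ c K) {R x : ℝ} (hx : |x| ≤ R) :
    c / (1 + R) * x ^ 2 ≤ x * φ x := by
  have key : ∀ y, 0 ≤ y → y ≤ R → c / (1 + R) * y ^ 2 ≤ y * φ y := by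
    intro y h0 h1
    have := h.lower y h0
    calc c / (1 + R) * y ^ 2 ≤ c / (1 + y) * y ^ 2 := by
          have := h.pos
          gcongr
      _ = y * (c * y / (1 + y)) := by ring
      _ ≤ y * φ y := by gcongr
  rcases le_total 0 x with h0 | h0
  · exact key x h0 (by rwa [abs_of_nonneg h0] at hx)
  · have := key (-x) (by linarith) (by rwa [abs_of_nonpos h0] at hx)
    rw [h.odd] at this
    linarith

theorem continuous (h : SaturationLike φ c K) : Continuous φ := h.lipschitz.continuous

theorem hasDerivAt_primitive (h : SaturationLike φ c K) (s : ℝ) :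
    HasDerivAt (fun s => ∫ τ in (0 : ℝ)..s, φ τ) (φ s) s :=
  intervalIntegral.integral_hasDerivAt_right (h.continuous.intervalIntegrable _ _)
    h.continuous.stronglyMeasurable.stronglyMeasurableAtFilter h.continuous.continuousAt

theorem primitive_neg (h : SaturationLike φ c K) (s : ℝ) :
    ∫ τ in (0 : ℝ)..(-s), φ τ = ∫ τ in (0 : ℝ)..s, φ τ := by
  have := intervalIntegral.integral_comp_neg (a := 0) (b := s) φ
  simp only [h.odd, intervalIntegral.integral_neg, neg_zero] at this
  rw [intervalIntegral.integral_symm, ← this, neg_neg]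

theorem primitive_abs (h : SaturationLike φ c K) (s : ℝ) :
    ∫ τ in (0 : ℝ)..|s|, φ τ = ∫ τ in (0 : ℝ)..s, φ τ := by
  rcases abs_choice s with e | e
  · rw [e]
  · rw [e, h.primitive_neg]

theorem primitive_lower (h : SaturationLike φ c K) {R s : ℝ} (hs : |s| ≤ R) :
    c / (1 + R) / 2 * s ^ 2 ≤ ∫ τ in (0 : ℝ)..s, φ τ := by
  have h1 : ∫ τ in (0 : ℝ)..|s|, c / (1 + R) * τ ≤ ∫ τ in (0 : ℝ)..|s|, φ τ := by
    refine intervalIntegral.integral_mono_on (abs_nonneg s)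
      ((by fun_prop : Continuous fun τ : ℝ => c / (1 + R) * τ).intervalIntegrable _ _)
      (h.continuous.intervalIntegrable _ _) ?_
    rintro τ ⟨h0, h1⟩
    refine le_trans ?_ (h.lower τ h0)
    have := h.pos
    rw [mul_div_right_comm]
    gcongr
    exact h1.trans hs
  rw [h.primitive_abs, intervalIntegral.integral_const_mul, integral_id, sq_abs] at h1
  linarith

theorem primitive_upper (h : SaturationLike φ c K) (s : ℝ) :
    ∫ τ in (0 : ℝ)..s, φ τ ≤ K / 2 * s ^ 2 := by
  have h1 : ∫ τ in (0 : ℝ)..|s|, φ τ ≤ ∫ τ in (0 : ℝ)..|s|, K * τ := by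
    refine intervalIntegral.integral_mono_on (abs_nonneg s)
      (h.continuous.intervalIntegrable _ _)
      ((by fun_prop : Continuous fun τ : ℝ => (K : ℝ) * τ).intervalIntegrable _ _) ?_
    rintro τ ⟨h0, h1⟩
    have := h.abs_le τ
    rw [abs_of_nonneg h0] at this
    exact (le_abs_self _).trans this
  rw [h.primitive_abs, intervalIntegral.integral_const_mul, integral_id, sq_abs] at h1
  linarith

end SaturationLike

/-! ### The scalar saturated double integrator -/

/-- `(q, w)` solves the saturated double integrator `q'' = -φ (kp q + kv q')` on `[0, ∞)`. -/
structure IsSaturatedSolution (φ : ℝ → ℝ) (kp kv : ℝ) (q w : ℝ → ℝ) : Prop where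
  position : ∀ t, 0 ≤ t → HasDerivWithinAt q (w t) (Ici 0) t
  velocity : ∀ t, 0 ≤ t → HasDerivWithinAt w (-φ (kp * q t + kv * w t)) (Ici 0) t

/-- A locally finite set of exceptional times is harmless when the right side is continuous. -/
theorem hasDerivWithinAt_of_locFinite {w g : ℝ → ℝ} {D : Set ℝ} (hD : LocFinite D)
    (hw : ContinuousOn w (Ici 0)) (hg : ContinuousOn g (Ici 0))
    (h : ∀ t, 0 ≤ t → t ∉ D → HasDerivWithinAt w (g t) (Ici 0) t) (t : ℝ) (ht : 0 ≤ t) :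
    HasDerivWithinAt w (g t) (Ici 0) t := by
  set G : ℝ → ℝ := fun x => g (max x 0) with hGdef
  have hGc : Continuous G :=
    hg.comp_continuous (by fun_prop) fun x => le_max_right x 0
  have hG : ∀ x, 0 ≤ x → G x = g x := fun x hx => by simp [hGdef, max_eq_left hx]
  -- The fundamental theorem of calculus tolerates countably many exceptional points, so `w` is a
  -- primitive of a continuous function and is differentiable at the exceptional times too.
  have key : ∀ x ∈ Ici (0 : ℝ), w x = w 0 + ∫ τ in (0 : ℝ)..x, G τ := by
    intro x hx
    rw [MeasureTheory.integral_eq_of_hasDerivAt_off_countable_of_le w G hx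
      (hD x).countable (hw.mono Icc_subset_Ici_self) ?_ (hGc.intervalIntegrable _ _)]
    · ring
    · rintro y ⟨⟨h0, h1⟩, h2⟩
      rw [hG y h0.le]
      exact (h y h0.le fun h3 => h2 ⟨h3, h0.le, h1.le⟩).hasDerivAt (Ici_mem_nhds h0)
  have h1 : HasDerivAt (fun x => w 0 + ∫ τ in (0 : ℝ)..x, G τ) (G t) t :=
    (intervalIntegral.integral_hasDerivAt_right (hGc.intervalIntegrable _ _)
      hGc.stronglyMeasurable.stronglyMeasurableAtFilter hGc.continuousAt).const_add _
  rw [hG t ht] at h1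
  exact h1.hasDerivWithinAt.congr key (key t ht)

theorem antitoneOn_Ici_of_hasDerivWithinAt_nonpos {V V' : ℝ → ℝ}
    (hV : ∀ t, 0 ≤ t → HasDerivWithinAt V (V' t) (Ici 0) t) (h : ∀ t, 0 ≤ t → V' t ≤ 0) :
    AntitoneOn V (Ici 0) := by
  refine antitoneOn_of_hasDerivWithinAt_nonpos (convex_Ici 0)
    (fun t ht => (hV t ht).continuousWithinAt) (f' := V') ?_ ?_
  · intro t ht
    rw [interior_Ici] at ht ⊢
    exact (hV t (le_of_lt ht)).mono Ioi_subset_Ici_self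
  · intro t ht
    rw [interior_Ici] at ht
    exact h t (le_of_lt ht)

namespace IsSaturatedSolution

variable {φ : ℝ → ℝ} {c kp kv : ℝ} {K : NNReal} {q w : ℝ → ℝ}

theorem hasDerivWithinAt_feedback (h : IsSaturatedSolution φ kp kv q w) {t : ℝ} (ht : 0 ≤ t) :
    HasDerivWithinAt (fun t => kp * q t + kv * w t)
      (kp * w t - kv * φ (kp * q t + kv * w t)) (Ici 0) t := by
  have := ((h.position t ht).const_mul kp).add ((h.velocity t ht).const_mul kv)
  exact this.congr_deriv (by ring)

/-- The energy along a trajectory. -/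
theorem hasDerivWithinAt_energy (hφ : SaturationLike φ c K)
    (h : IsSaturatedSolution φ kp kv q w) {t : ℝ} (ht : 0 ≤ t) :
    HasDerivWithinAt (fun t => (∫ τ in (0 : ℝ)..(kp * q t + kv * w t), φ τ) + kp / 2 * w t ^ 2)
      (-kv * φ (kp * q t + kv * w t) ^ 2) (Ici 0) t := by
  have h1 := (hφ.hasDerivAt_primitive (kp * q t + kv * w t)).comp_hasDerivWithinAt t
    (h.hasDerivWithinAt_feedback ht)
  have h2 := ((h.velocity t ht).pow 2).const_mul (kp / 2)
  -- The terms `kp * φ(s) * w` of the two summands cancel.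
  exact (h1.add h2).congr_deriv (by push_cast; ring)

theorem energy_le (hφ : SaturationLike φ c K) (hkv : 0 < kv)
    (h : IsSaturatedSolution φ kp kv q w) {t : ℝ} (ht : 0 ≤ t) :
    (∫ τ in (0 : ℝ)..(kp * q t + kv * w t), φ τ) + kp / 2 * w t ^ 2 ≤
      (∫ τ in (0 : ℝ)..(kp * q 0 + kv * w 0), φ τ) + kp / 2 * w 0 ^ 2 :=
  antitoneOn_Ici_of_hasDerivWithinAt_nonpos (fun _ ht => h.hasDerivWithinAt_energy hφ ht)
    (fun t _ => by nlinarith [sq_nonneg (φ (kp * q t + kv * w t))]) self_mem_Ici ht ht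

/-- The lower bound on the primitive is taken with `R = |s(t)|` itself, so no prior bound on `s` is
needed. The left side is quadratic in `|s(t)|` and the right side only linear. -/
theorem sq_feedback_le (hφ : SaturationLike φ c K) (hkp : 0 < kp) (hkv : 0 < kv)
    (h : IsSaturatedSolution φ kp kv q w) {t : ℝ} (ht : 0 ≤ t) :
    c * (kp * q t + kv * w t) ^ 2 ≤ (1 + |kp * q t + kv * w t|) *
      (K * (kp * q 0 + kv * w 0) ^ 2 + kp * w 0 ^ 2) := by
  have h1 := h.energy_le hφ hkv ht
  have h2 := hφ.primitive_lower (le_refl |kp * q t + kv * w t|)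
  have h3 := hφ.primitive_upper (kp * q 0 + kv * w 0)
  have h4 : 0 < 1 + |kp * q t + kv * w t| := by positivity
  have h5 : c / (1 + |kp * q t + kv * w t|) / 2 * (kp * q t + kv * w t) ^ 2 ≤
      (K * (kp * q 0 + kv * w 0) ^ 2 + kp * w 0 ^ 2) / 2 := by
    have : 0 ≤ kp / 2 * w t ^ 2 := by positivity
    linarith
  rw [div_div, div_mul_eq_mul_div, div_le_div_iff₀ (by positivity) two_pos] at h5
  nlinarith

theorem sq_velocity_le (hφ : SaturationLike φ c K) (hkv : 0 < kv)
    (h : IsSaturatedSolution φ kp kv q w) {t : ℝ} (ht : 0 ≤ t) :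
    kp * w t ^ 2 ≤ K * (kp * q 0 + kv * w 0) ^ 2 + kp * w 0 ^ 2 := by
  have h1 := h.energy_le hφ hkv ht
  have h2 := hφ.primitive_lower (le_refl |kp * q t + kv * w t|)
  have h3 := hφ.primitive_upper (kp * q 0 + kv * w 0)
  have h4 : 0 ≤ c / (1 + |kp * q t + kv * w t|) / 2 * (kp * q t + kv * w t) ^ 2 := by
    have := hφ.pos
    positivity
  linarith

theorem exists_bound_feedback (hφ : SaturationLike φ c K) (hkp : 0 < kp) (hkv : 0 < kv)
    (h : IsSaturatedSolution φ kp kv q w) :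
    ∃ R, 0 < R ∧ ∀ t, 0 ≤ t → |kp * q t + kv * w t| ≤ R := by
  set A := K * (kp * q 0 + kv * w 0) ^ 2 + kp * w 0 ^ 2 with hA
  have hA0 : 0 ≤ A := by positivity
  have hc := hφ.pos
  -- If `|x| > 1` then `1 + |x| < 2|x|`, and `c x² ≤ (1 + |x|) A` forces `|x| ≤ 2A / c`.
  refine ⟨1 + 2 * A / c, by positivity, fun t ht => ?_⟩
  have h1 := h.sq_feedback_le hφ hkp hkv ht
  rw [← hA] at h1
  set x := kp * q t + kv * w t
  by_contra! hlt
  have h2 : 2 * A / c < |x| := by linarith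
  have h3 : (1 : ℝ) < |x| := lt_of_le_of_lt (by have : 0 ≤ 2 * A / c := by positivity
                                                linarith) hlt
  rw [div_lt_iff₀ hc] at h2
  rw [← sq_abs] at h1
  nlinarith

/-- The energy alone dissipates only through `φ(s)`. The derivative of `-ε s w` supplies the missing
`-ε kp w²`, and its other terms are absorbed for small `ε`. The sector constant `m`, hence the
exponential rate, depends on the trajectory through `R`. -/
theorem tendsto_zero (hφ : SaturationLike φ c K) (hkp : 0 < kp) (hkv : 0 < kv)
    (h : IsSaturatedSolution φ kp kv q w) :
    Tendsto q atTop (𝓝 0) ∧ Tendsto w atTop (𝓝 0) := by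
  obtain ⟨R, hR, hb⟩ := h.exists_bound_feedback hφ hkp hkv
  have hc := hφ.pos
  set s : ℝ → ℝ := fun t => kp * q t + kv * w t with hs
  obtain ⟨m, hm, hme⟩ : ∃ m, 0 < m ∧ m = c / (1 + R) := ⟨_, by positivity, rfl⟩
  -- the weight of the cross term
  obtain ⟨ε, hε, hε1, hε2, hε3⟩ : ∃ ε : ℝ, 0 < ε ∧ ε ≤ m / 2 ∧ ε ≤ kp / 2 ∧
      ε * (kv ^ 2 / (2 * kp) + 1 / m) ≤ kv / 2 := by
    refine ⟨min (min (m / 2) (kp / 2)) (kv / 2 / (kv ^ 2 / (2 * kp) + 1 / m)), by positivity,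
      (min_le_left _ _).trans (min_le_left _ _), (min_le_left _ _).trans (min_le_right _ _), ?_⟩
    rw [← le_div_iff₀ (by positivity)]
    exact min_le_right _ _
  set W : ℝ → ℝ := fun t => (∫ τ in (0 : ℝ)..(s t), φ τ) + kp / 2 * w t ^ 2 - ε * (s t * w t)
    with hW
  set W' : ℝ → ℝ := fun t => -kv * φ (s t) ^ 2 -
    ε * ((kp * w t - kv * φ (s t)) * w t + s t * (-φ (s t))) with hW'
  have hWd : ∀ t, 0 ≤ t → HasDerivWithinAt W (W' t) (Ici 0) t := fun t ht =>
    (h.hasDerivWithinAt_energy hφ ht).sub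
      (((h.hasDerivWithinAt_feedback ht).mul (h.velocity t ht)).const_mul ε)
  obtain ⟨a, ha, hlow⟩ : ∃ a, 0 < a ∧ ∀ t, 0 ≤ t → a * (s t ^ 2 + w t ^ 2) ≤ W t := by
    -- The energy is at least `m/2 s² + kp/2 w²`; by `ε ≤ m/2` and `ε ≤ kp/2` the cross term costs
    -- at most half of it.
    refine ⟨min (m / 4) (kp / 4), by positivity, fun t ht => ?_⟩
    have h1 := hφ.primitive_lower (hb t ht)
    rw [← hme] at h1
    have h2 : ε * (s t * w t) ≤ m / 4 * s t ^ 2 + kp / 4 * w t ^ 2 := by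
      have : s t * w t ≤ s t ^ 2 / 2 + w t ^ 2 / 2 := by nlinarith [sq_nonneg (s t - w t)]
      nlinarith [sq_nonneg (s t), sq_nonneg (w t)]
    have h3 := min_le_left (m / 4) (kp / 4)
    have h4 := min_le_right (m / 4) (kp / 4)
    simp only [hW]
    nlinarith [sq_nonneg (s t), sq_nonneg (w t)]
  obtain ⟨b, hb0, hup⟩ : ∃ b, 0 < b ∧ ∀ t, 0 ≤ t → W t ≤ b * (s t ^ 2 + w t ^ 2) := by
    refine ⟨K / 2 + kp / 2 + ε, by positivity, fun t ht => ?_⟩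
    have h1 := hφ.primitive_upper (s t)
    have h2 : -(s t * w t) ≤ s t ^ 2 + w t ^ 2 := by
      nlinarith [sq_nonneg (s t + w t), sq_nonneg (s t), sq_nonneg (w t)]
    have h3 : ε * -(s t * w t) ≤ ε * (s t ^ 2 + w t ^ 2) := by gcongr
    have h4 : 0 ≤ (K / 2 : ℝ) * w t ^ 2 := by positivity
    have h5 : 0 ≤ kp / 2 * s t ^ 2 := by positivity
    simp only [hW]
    linarith
  obtain ⟨l, hl, hdecay⟩ : ∃ l, 0 < l ∧ ∀ t, 0 ≤ t → W' t ≤ -l * (s t ^ 2 + w t ^ 2) := by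
    -- Half of `kv φ(s)²` and half of `ε kp w²` absorb the indefinite terms (`e5`); the remaining
    -- halves give the decay, with `φ(s)² ≥ m² s²`.
    refine ⟨min (kv / 2 * m ^ 2) (ε * kp / 2), by positivity, fun t ht => ?_⟩
    have h1 := hφ.sector (hb t ht)
    rw [← hme] at h1
    have e1 : m * |s t| ≤ |φ (s t)| := by
      rcases (abs_nonneg (s t)).eq_or_lt with h0 | h0
      · rw [← h0, mul_zero]; positivity
      · refine le_of_mul_le_mul_left ?_ h0
        calc |s t| * (m * |s t|) = m * s t ^ 2 := by rw [← sq_abs]; ring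
          _ ≤ s t * φ (s t) := h1
          _ ≤ |s t| * |φ (s t)| := by rw [← abs_mul]; exact le_abs_self _
    have e2 : m ^ 2 * s t ^ 2 ≤ φ (s t) ^ 2 := by
      rw [← sq_abs (s t), ← sq_abs (φ (s t)), ← mul_pow]
      gcongr
    have e3 : s t * φ (s t) ≤ 1 / m * φ (s t) ^ 2 := by
      calc s t * φ (s t) ≤ |s t| * |φ (s t)| := by rw [← abs_mul]; exact le_abs_self _
        _ ≤ (|φ (s t)| / m) * |φ (s t)| := by
            gcongr
            rw [le_div_iff₀ hm]; linarith
        _ = 1 / m * φ (s t) ^ 2 := by rw [← sq_abs (φ (s t))]; ring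
    have e4 : kv * φ (s t) * w t ≤ kp / 2 * w t ^ 2 + kv ^ 2 / (2 * kp) * φ (s t) ^ 2 := by
      have : 0 ≤ (kp * w t - kv * φ (s t)) ^ 2 / (2 * kp) := by positivity
      have e : (kp * w t - kv * φ (s t)) ^ 2 / (2 * kp) =
        kp / 2 * w t ^ 2 + kv ^ 2 / (2 * kp) * φ (s t) ^ 2 - kv * φ (s t) * w t := by
        field_simp; ring
      linarith
    have e5 : ε * (kv * φ (s t) * w t + s t * φ (s t)) ≤
        ε * (kp / 2 * w t ^ 2) + kv / 2 * φ (s t) ^ 2 := by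
      calc ε * (kv * φ (s t) * w t + s t * φ (s t)) ≤
          ε * (kp / 2 * w t ^ 2 + kv ^ 2 / (2 * kp) * φ (s t) ^ 2 + 1 / m * φ (s t) ^ 2) := by
            gcongr
        _ = ε * (kp / 2 * w t ^ 2) +
            ε * (kv ^ 2 / (2 * kp) + 1 / m) * φ (s t) ^ 2 := by ring
        _ ≤ _ := by gcongr
    have h3 := min_le_left (kv / 2 * m ^ 2) (ε * kp / 2)
    have h4 := min_le_right (kv / 2 * m ^ 2) (ε * kp / 2)
    have h5 := mul_le_mul_of_nonneg_right h3 (sq_nonneg (s t))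
    have h6 := mul_le_mul_of_nonneg_right h4 (sq_nonneg (w t))
    have h7 := mul_le_mul_of_nonneg_left e2 (by positivity : 0 ≤ kv / 2)
    simp only [hW']
    linarith
  -- `W' ≤ -l (s² + w²) ≤ -(l/b) W`, in integrated form.
  have hanti : AntitoneOn (fun t => Real.exp (l / b * t) * W t) (Ici 0) := by
    refine antitoneOn_Ici_of_hasDerivWithinAt_nonpos
      (V' := fun t => Real.exp (l / b * t) * (l / b) * W t + Real.exp (l / b * t) * W' t)
      (fun t ht => ?_) fun t ht => ?_
    · refine HasDerivWithinAt.mul (HasDerivAt.hasDerivWithinAt ?_) (hWd t ht)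
      simpa using ((hasDerivAt_id t).const_mul (l / b)).exp
    · have h1 := hup t ht
      have h2 := hdecay t ht
      have h3 : l / b * W t ≤ l * (s t ^ 2 + w t ^ 2) := by
        calc l / b * W t ≤ l / b * (b * (s t ^ 2 + w t ^ 2)) := by gcongr
          _ = _ := by field_simp
      have h4 := Real.exp_pos (l / b * t)
      have : Real.exp (l / b * t) * (l / b) * W t + Real.exp (l / b * t) * W' t =
        Real.exp (l / b * t) * (l / b * W t + W' t) := by ring
      rw [this]
      exact mul_nonpos_of_nonneg_of_nonpos h4.le (by linarith)
  have hexp : Tendsto (fun t => W 0 / a * Real.exp (-(l / b * t))) atTop (𝓝 0) := by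
    have : Tendsto (fun t : ℝ => l / b * t) atTop atTop :=
      tendsto_id.const_mul_atTop (by positivity)
    simpa using (Real.tendsto_exp_neg_atTop_nhds_zero.comp this).const_mul (W 0 / a)
  have hsq : Tendsto (fun t => s t ^ 2 + w t ^ 2) atTop (𝓝 0) := by
    refine squeeze_zero' (Eventually.of_forall fun t => by positivity) ?_ hexp
    filter_upwards [eventually_ge_atTop 0] with t ht
    have h1 := hanti self_mem_Ici ht ht
    simp only [mul_zero, Real.exp_zero, one_mul] at h1
    have h2 := hlow t ht
    rw [Real.exp_neg, ← div_eq_mul_inv, div_div, le_div_iff₀ (by positivity)]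
    calc (s t ^ 2 + w t ^ 2) * (a * Real.exp (l / b * t))
        = Real.exp (l / b * t) * (a * (s t ^ 2 + w t ^ 2)) := by ring
      _ ≤ Real.exp (l / b * t) * W t := by gcongr
      _ ≤ W 0 := h1
  have of_sq : ∀ f : ℝ → ℝ, (∀ t, f t ^ 2 ≤ s t ^ 2 + w t ^ 2) → Tendsto f atTop (𝓝 0) := by
    intro f hf
    have h1 : Tendsto (fun t => f t ^ 2) atTop (𝓝 0) :=
      squeeze_zero (fun t => sq_nonneg _) hf hsq
    have h2 := h1.sqrt
    simp only [Real.sqrt_sq_eq_abs, Real.sqrt_zero] at h2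
    exact (tendsto_zero_iff_abs_tendsto_zero _).2 h2
  have hw0 := of_sq w fun t => by nlinarith [sq_nonneg (s t)]
  have hs0 := of_sq s fun t => by nlinarith [sq_nonneg (w t)]
  refine ⟨?_, hw0⟩
  have := (hs0.sub (hw0.const_mul kv)).div_const kp
  simp only [mul_zero, sub_zero, zero_div] at this
  refine this.congr fun t => ?_
  simp only [hs]
  field_simp
  ring

end IsSaturatedSolution

theorem saturated_stable {φ : ℝ → ℝ} {c kp kv : ℝ} {K : NNReal} (hφ : SaturationLike φ c K)
    (hkp : 0 < kp) (hkv : 0 < kv) {ε : ℝ} (hε : 0 < ε) :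
    ∃ η : ℝ, 0 < η ∧ ∀ q w : ℝ → ℝ, IsSaturatedSolution φ kp kv q w → |q 0| < η → |w 0| < η →
      ∀ t, 0 ≤ t → |q t| < ε ∧ |w t| < ε := by
  have hc := hφ.pos
  -- a common bound for the velocity and the feedback that suffices
  obtain ⟨r, hr, hr1, hr2⟩ : ∃ r : ℝ, 0 < r ∧ r ≤ ε ∧ (1 + kv) * r ≤ kp * ε := by
    refine ⟨min ε (kp * ε / (1 + kv)), by positivity, min_le_left _ _, ?_⟩
    rw [mul_comm, ← le_div_iff₀ (by positivity)]
    exact min_le_right _ _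
  -- `δ` bounds twice the initial energy: the first condition will force `|w| < r`, the second `|s|
  -- < r`.
  obtain ⟨δ, hδ, hδ1, hδ2⟩ : ∃ δ : ℝ, 0 < δ ∧ δ ≤ kp * r ^ 2 ∧ δ * (1 + r) ≤ c * r ^ 2 := by
    refine ⟨min (kp * r ^ 2) (c * r ^ 2 / (1 + r)), by positivity, min_le_left _ _, ?_⟩
    rw [← le_div_iff₀ (by positivity)]
    exact min_le_right _ _
  have hcont : Continuous fun x : ℝ × ℝ => (K : ℝ) * (kp * x.1 + kv * x.2) ^ 2 + kp * x.2 ^ 2 := by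
    fun_prop
  have hnear := (hcont.tendsto (0, 0)).eventually_lt_const (u := δ) (by simpa using hδ)
  obtain ⟨η, hη, hball⟩ := Metric.eventually_nhds_iff.1 hnear
  refine ⟨η, hη, fun q w h hq hw t ht => ?_⟩
  have hA := @hball (q 0, w 0) (by simpa [Prod.dist_eq, Real.dist_eq] using And.intro hq hw)
  simp only at hA
  have hw' : |w t| < r := by
    have := h.sq_velocity_le hφ hkv ht
    refine abs_lt_of_sq_lt_sq ?_ hr.le
    nlinarith
  have hs' : |kp * q t + kv * w t| < r := by
    have h1 := h.sq_feedback_le hφ hkp hkv ht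
    set x := kp * q t + kv * w t
    -- `x² / (1 + x)` increases for `x ≥ 0`, so `|x| ≥ r` would contradict `δ ≤ c r² / (1 + r)`.
    by_contra! hle
    rw [← sq_abs] at h1
    have h2 : (1 + |x|) * (K * (kp * q 0 + kv * w 0) ^ 2 + kp * w 0 ^ 2) < (1 + |x|) * δ := by
      gcongr
    have h3 : δ * (1 + |x|) * r ≤ c * r ^ 2 * |x| := by nlinarith
    have h4 : c * r ^ 2 * |x| ≤ c * |x| ^ 2 * r := by
      have : c * r * |x| * r ≤ c * r * |x| * |x| := by gcongr
      linarith
    have h5 : c * |x| ^ 2 * r < δ * (1 + |x|) * r :=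
      mul_lt_mul_of_pos_right (by linarith) hr
    linarith
  refine ⟨?_, hw'.trans_le hr1⟩
  have h1 : kp * |q t| < kp * ε := by
    calc kp * |q t| = |(kp * q t + kv * w t) - kv * w t| := by
          rw [add_sub_cancel_right, abs_mul, abs_of_pos hkp]
      _ ≤ |kp * q t + kv * w t| + |kv * w t| := abs_sub _ _
      _ = |kp * q t + kv * w t| + kv * |w t| := by rw [abs_mul, abs_of_pos hkv]
      _ < r + kv * r := by gcongr
      _ = (1 + kv) * r := by ring
      _ ≤ kp * ε := hr2
  exact lt_of_mul_lt_mul_left h1 hkp.le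

/-! ### Global existence for Lipschitz equations -/

open BoundedContinuousFunction MeasureTheory in
/-- An autonomous equation with a globally Lipschitz right side that vanishes at the origin has
solutions on `[0, ∞)`: the integral operator is a contraction for an exponentially weighted norm. -/
theorem exists_global_solution {E : Type*} [NormedAddCommGroup E] [NormedSpace ℝ E]
    [CompleteSpace E] {f : E → E} {K : NNReal} (hf : LipschitzWith K f) (hf0 : f 0 = 0) (z₀ : E) :
    ∃ z : ℝ → E, z 0 = z₀ ∧ ∀ t, 0 ≤ t → HasDerivWithinAt z (f (z t)) (Ici 0) t := by
  -- The weight makes `K / l ≤ 1/2`, the contraction constant; the `+ 1` keeps `l` positive when `K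
  -- = 0`. A curve `z` is represented by the bounded function `exp (-l t) z(t)`.
  set l : ℝ := 2 * K + 1 with hl
  have hl0 : 0 < l := by positivity
  -- the right side along the curve with weighted representation `g`
  set F : (ℝ →ᵇ E) → ℝ → E := fun g τ => f (Real.exp (l * τ) • g τ) with hF
  have hFc : ∀ g, Continuous (F g) := fun g => hf.continuous.comp (by fun_prop)
  have hFi : ∀ g a b, IntervalIntegrable (F g) volume a b :=
    fun g a b => (hFc g).intervalIntegrable a b
  have hFd : ∀ g h τ, ‖F g τ - F h τ‖ ≤ K * dist g h * Real.exp (l * τ) := by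
    intro g h τ
    rw [← dist_eq_norm]
    calc dist (F g τ) (F h τ) ≤ K * dist (Real.exp (l * τ) • g τ) (Real.exp (l * τ) • h τ) :=
          hf.dist_le_mul _ _
      _ = K * (Real.exp (l * τ) * dist (g τ) (h τ)) := by
          rw [dist_smul₀, Real.norm_eq_abs, Real.abs_exp]
      _ ≤ K * (Real.exp (l * τ) * dist g h) := by
          gcongr
          exact dist_coe_le_dist τ
      _ = _ := by ring
  have hexpint : ∀ (C T : ℝ), 0 ≤ C → 0 ≤ T →
      ∫ τ in (0 : ℝ)..T, K * C * Real.exp (l * τ) ≤ C / 2 * Real.exp (l * T) := by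
    intro C T hC hT
    have h1 : ∫ τ in (0 : ℝ)..T, K * C * Real.exp (l * τ) =
        K * C / l * Real.exp (l * T) - K * C / l * Real.exp (l * 0) := by
      refine intervalIntegral.integral_eq_sub_of_hasDerivAt (f := fun τ =>
        K * C / l * Real.exp (l * τ)) (fun τ _ => ?_) (Continuous.intervalIntegrable
          (by fun_prop) _ _)
      have := (((hasDerivAt_id τ).const_mul l).exp).const_mul (K * C / l)
      refine this.congr_deriv ?_
      simp only [id]
      field_simp
    have h2 : K * C / l ≤ C / 2 := by
      rw [div_le_div_iff₀ hl0 two_pos]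
      nlinarith [K.coe_nonneg]
    have h3 : 0 ≤ K * C / l := by positivity
    rw [h1, mul_zero, Real.exp_zero]
    have := mul_le_mul_of_nonneg_right h2 (Real.exp_pos (l * T)).le
    linarith
  have hFint : ∀ g h T, 0 ≤ T → ‖(∫ τ in (0 : ℝ)..T, F g τ) - ∫ τ in (0 : ℝ)..T, F h τ‖ ≤
      dist g h / 2 * Real.exp (l * T) := by
    intro g h T hT
    rw [← intervalIntegral.integral_sub (hFi g _ _) (hFi h _ _)]
    exact (intervalIntegral.norm_integral_le_of_norm_le hT
      (Eventually.of_forall fun τ _ => hFd g h τ)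
      (Continuous.intervalIntegrable (by fun_prop) _ _)).trans (hexpint _ _ dist_nonneg hT)
  have hF0 : ∀ T, ∫ τ in (0 : ℝ)..T, F 0 τ = 0 := by
    intro T
    simp [hF, hf0]
  -- With `max t 0` the operator acts on functions on all of `ℝ`; its value is `z₀` at negative
  -- times.
  set Ψ : (ℝ →ᵇ E) → ℝ → E := fun g t =>
    Real.exp (-(l * max t 0)) • (z₀ + ∫ τ in (0 : ℝ)..(max t 0), F g τ) with hΨ
  have hΨc : ∀ g, Continuous (Ψ g) := by
    intro g
    have h1 : Continuous fun t => ∫ τ in (0 : ℝ)..t, F g τ :=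
      intervalIntegral.continuous_primitive (hFi g) 0
    have h2 := h1.comp (by fun_prop : Continuous fun t : ℝ => max t 0)
    exact Continuous.smul (by fun_prop) (continuous_const.add h2)
  have hΨd : ∀ g h t, ‖Ψ g t - Ψ h t‖ ≤ dist g h / 2 := by
    intro g h t
    simp only [hΨ]
    rw [← smul_sub, add_sub_add_left_eq_sub, norm_smul, Real.norm_eq_abs, Real.abs_exp,
      Real.exp_neg, inv_mul_le_iff₀ (Real.exp_pos _), mul_comm (Real.exp _)]
    exact hFint g h _ (le_max_right _ _)
  -- Here `f 0 = 0` enters: the image of the zero function is bounded, and then by `hΨd` so is every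
  -- image.
  have hΨ0 : ∀ t, ‖Ψ 0 t‖ ≤ ‖z₀‖ := by
    intro t
    simp only [hΨ, hF0, add_zero]
    rw [norm_smul, Real.norm_eq_abs, Real.abs_exp]
    refine mul_le_of_le_one_left (norm_nonneg _) (Real.exp_le_one_iff.2 ?_)
    have := mul_nonneg hl0.le (le_max_right t 0)
    linarith
  have hΨb : ∀ g t, ‖Ψ g t‖ ≤ dist g 0 / 2 + ‖z₀‖ := by
    intro g t
    have h1 := norm_add_le (Ψ g t - Ψ 0 t) (Ψ 0 t)
    rw [sub_add_cancel] at h1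
    exact h1.trans (add_le_add (hΨd g 0 t) (hΨ0 t))
  set T : (ℝ →ᵇ E) → (ℝ →ᵇ E) := fun g =>
    BoundedContinuousFunction.ofNormedAddCommGroup (Ψ g) (hΨc g) _ (hΨb g) with hT
  have hTc : ContractingWith (1 / 2 : NNReal) T := by
    refine ⟨by rw [← NNReal.coe_lt_coe]; norm_num, LipschitzWith.of_dist_le_mul fun g h => ?_⟩
    refine (BoundedContinuousFunction.dist_le (by positivity)).2 fun t => ?_
    rw [dist_eq_norm]
    refine (hΨd g h t).trans (le_of_eq ?_)
    push_cast
    ring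
  obtain ⟨g, hg⟩ : ∃ g, T g = g := ⟨_, hTc.fixedPoint_isFixedPt⟩
  have hgt : ∀ t, 0 ≤ t → Real.exp (l * t) • g t = z₀ + ∫ τ in (0 : ℝ)..t, F g τ := by
    intro t ht
    have h1 : g t = Ψ g t := by
      conv_lhs => rw [← hg]
      rfl
    rw [h1]
    simp only [hΨ, max_eq_left ht]
    rw [smul_smul, ← Real.exp_add, add_neg_cancel, Real.exp_zero, one_smul]
  refine ⟨fun t => z₀ + ∫ τ in (0 : ℝ)..t, F g τ, by simp, fun t ht => ?_⟩
  simp only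
  rw [← hgt t ht]
  exact ((intervalIntegral.integral_hasDerivAt_right (hFi g _ _)
    (hFc g).stronglyMeasurable.stronglyMeasurableAtFilter
    (hFc g).continuousAt).const_add z₀).hasDerivWithinAt

theorem exists_saturatedSolution {φ : ℝ → ℝ} {c : ℝ} {K : NNReal} (hφ : SaturationLike φ c K)
    (kp kv q₀ w₀ : ℝ) :
    ∃ q w : ℝ → ℝ, IsSaturatedSolution φ kp kv q w ∧ q 0 = q₀ ∧ w 0 = w₀ := by
  have hlin : ∃ C, LipschitzWith C fun z : ℝ × ℝ => kp * z.1 + kv * z.2 :=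
    ⟨_, (kp • ContinuousLinearMap.fst ℝ ℝ ℝ + kv • ContinuousLinearMap.snd ℝ ℝ ℝ).lipschitz⟩
  obtain ⟨C, hC⟩ := hlin
  have hlip := LipschitzWith.prod_snd (α := ℝ) (β := ℝ) |>.prodMk (hφ.lipschitz.comp hC).neg
  obtain ⟨z, hz0, hz⟩ := exists_global_solution hlip
    (by simp [hφ.map_zero]) ((q₀, w₀) : ℝ × ℝ)
  refine ⟨fun t => (z t).1, fun t => (z t).2, ⟨fun t ht => (hz t ht).fst, fun t ht =>
    (hz t ht).snd⟩, by simp [hz0], by simp [hz0]⟩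

/-! ### Linear algebra of the bearing Laplacian -/

variable {nl nf d : ℕ}

/-- `act A` as a linear map. -/
def actL (A : Matrix (Fin d) (Fin d) ℝ) : Pt d →ₗ[ℝ] Pt d where
  toFun := act A
  map_add' x y := by simp [act, Matrix.mulVec_add]
  map_smul' c x := by simp [act, Matrix.mulVec_smul]

@[simp] theorem actL_apply (A : Matrix (Fin d) (Fin d) ℝ) (x : Pt d) : actL A x = act A x := rfl

theorem act_mul (A B : Matrix (Fin d) (Fin d) ℝ) (x : Pt d) : act (A * B) x = act A (act B x) := by
  simp [act, Matrix.mulVec_mulVec]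

theorem act_one (x : Pt d) : act 1 x = x := by simp [act]

theorem act_neg (A : Matrix (Fin d) (Fin d) ℝ) (x : Pt d) : act (-A) x = -act A x := by
  simp [act, Matrix.neg_mulVec]

theorem act_zero (x : Pt d) : act 0 x = 0 := by simp [act]

theorem act_sum {ι : Type*} (s : Finset ι) (A : ι → Matrix (Fin d) (Fin d) ℝ) (x : Pt d) :
    act (∑ j ∈ s, A j) x = ∑ j ∈ s, act (A j) x := by
  classical
  induction s using Finset.induction_on with
  | empty => simp [act_zero]
  | insert a s ha ih => rw [Finset.sum_insert ha, Finset.sum_insert ha, ← ih]; simp [act, Matrix.add_mulVec]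

theorem act_projMat (g x : Pt d) : act (projMat g) x = x - inner ℝ g x • g := by
  ext k
  simp [act, projMat, Matrix.sub_mulVec, Matrix.vecMulVec_mulVec, PiLp.inner_apply, dotProduct,
    mul_comm]

/-- `P_g` is a symmetric idempotent when `g` is a unit vector. -/
theorem inner_act_projMat {g : Pt d} (hg : ‖g‖ = 1) (x : Pt d) :
    inner ℝ x (act (projMat g) x) = ‖act (projMat g) x‖ ^ 2 := by
  rw [← real_inner_self_eq_norm_sq, act_projMat]
  simp only [inner_sub_left, inner_sub_right, inner_smul_left, inner_smul_right,
    real_inner_self_eq_norm_sq, hg, real_inner_comm x g]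
  simp

theorem act_projMat_self {g : Pt d} (hg : ‖g‖ = 1) : act (projMat g) g = 0 := by
  rw [act_projMat, real_inner_self_eq_norm_sq, hg]
  simp

theorem projMat_neg (g : Pt d) : projMat (-g) = projMat g := by
  simp [projMat, Matrix.neg_vecMulVec, Matrix.vecMulVec_neg]

namespace Setup

variable (F : Setup nl nf d)

theorem mem_nbrs {i j : Agent nl nf} : j ∈ F.nbrs i ↔ F.graph.Adj i j := by simp [nbrs]

/-- The follower rows of the bearing Laplacian: `z ↦ (∑_{j ∈ N_i} P_ij (z_i - z_j))_i`. -/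
def followerRows : (Agent nl nf → Pt d) →ₗ[ℝ] (Fin nf → Pt d) :=
  LinearMap.pi fun i => ∑ j ∈ F.nbrs (Sum.inr i),
    actL (F.P (Sum.inr i) j) ∘ₗ ((LinearMap.proj (Sum.inr i) : (Agent nl nf → Pt d) →ₗ[ℝ] Pt d) -
      LinearMap.proj j)

theorem followerRows_apply (z : Agent nl nf → Pt d) (i : Fin nf) :
    F.followerRows z i =
      ∑ j ∈ F.nbrs (Sum.inr i), act (F.P (Sum.inr i) j) (z (Sum.inr i) - z j) := by
  simp [followerRows]

theorem followerRows_apply' (z : Agent nl nf → Pt d) (i : Fin nf) :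
    F.followerRows z i = act (F.K (Sum.inr i)) (z (Sum.inr i)) -
      ∑ j ∈ F.nbrs (Sum.inr i), act (F.P (Sum.inr i) j) (z j) := by
  rw [followerRows_apply, K, act_sum, ← Finset.sum_sub_distrib]
  exact Finset.sum_congr rfl fun j _ => (actL _).map_sub _ _

end Setup

/-- `join` as a linear map. -/
def joinL : ((Fin nl → Pt d) × (Fin nf → Pt d)) →ₗ[ℝ] (Agent nl nf → Pt d) where
  toFun x := join x.1 x.2
  map_add' x y := by ext (i | i) <;> simp [join]
  map_smul' c x := by ext (i | i) <;> simp [join]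

@[simp] theorem joinL_apply (x : (Fin nl → Pt d) × (Fin nf → Pt d)) :
    joinL x = join x.1 x.2 := rfl

namespace Setup

variable (F : Setup nl nf d)

/-- The follower-follower block of the bearing Laplacian as a linear map. -/
def followerMap : (Fin nf → Pt d) →ₗ[ℝ] (Fin nf → Pt d) :=
  F.followerRows ∘ₗ joinL ∘ₗ LinearMap.inr ℝ (Fin nl → Pt d) (Fin nf → Pt d)

theorem followerMap_apply (x : Fin nf → Pt d) :
    F.followerMap x = F.followerRows (join 0 x) := rfl

theorem followerRows_join_sub (zl : Fin nl → Pt d) (x y : Fin nf → Pt d) :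
    F.followerRows (join zl x) - F.followerRows (join zl y) = F.followerMap (x - y) := by
  rw [← map_sub, followerMap_apply]
  congr 1
  ext (i | i) <;> simp [join]

namespace IsTarget

variable {F} {pl : ℝ → Fin nl → Pt d} {ps : ℝ → Agent nl nf → Pt d}

/-- A loop would have a zero difference vector, whose normalization is zero and not a unit vector.
-/
theorem not_adj_self (h : F.IsTarget pl ps) (i : Agent nl nf) : ¬ F.graph.Adj i i := by
  intro hi
  have h1 := h.bearing 0 le_rfl i i hi
  have h2 := F.norm_bearing i i hi
  rw [← h1] at h2
  simp at h2

/-- The target realizes both bearings, so they are opposite, and `P_g` is even in `g`. -/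
theorem P_symm (h : F.IsTarget pl ps) {i j : Agent nl nf} (hij : F.graph.Adj i j)
    (hji : F.graph.Adj j i) : F.P i j = F.P j i := by
  have : F.bearing i j = -F.bearing j i := by
    rw [← h.bearing 0 le_rfl i j hij, ← h.bearing 0 le_rfl j i hji, norm_sub_rev, ← smul_neg,
      neg_sub]
  rw [P, P, this, projMat_neg]

theorem act_P (h : F.IsTarget pl ps) {t : ℝ} (ht : 0 ≤ t) {i j : Agent nl nf}
    (hij : F.graph.Adj i j) : act (F.P i j) (ps t i - ps t j) = 0 := by
  have h1 := h.bearing t ht i j hij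
  have h2 : ‖ps t j - ps t i‖ ≠ 0 := by
    intro h0
    have h3 := F.norm_bearing i j hij
    rw [← h1, h0] at h3
    simp at h3
  have h3 : ps t i - ps t j = (-‖ps t j - ps t i‖) • F.bearing i j := by
    rw [← h1, smul_smul, neg_mul, mul_inv_cancel₀ h2, neg_one_smul, neg_sub]
  rw [h3, P, ← actL_apply, map_smul, actL_apply, act_projMat_self (F.norm_bearing i j hij),
    smul_zero]

theorem followerRows_eq_zero (h : F.IsTarget pl ps) {t : ℝ} (ht : 0 ≤ t) :
    F.followerRows (ps t) = 0 := by
  ext1 i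
  rw [followerRows_apply]
  exact Finset.sum_eq_zero fun j hj => h.act_P ht (F.mem_nbrs.1 hj)

theorem eq_join (h : F.IsTarget pl ps) {t : ℝ} (ht : 0 ≤ t) :
    ps t = join (pl t) (followers ps t) := by
  ext1 i
  rcases i with i | i
  · exact h.leader t ht i
  · rfl

/-- This makes the nonsingularity of `L_ff` available to the linear map. Absence of loops matters on
the diagonal, where the block is `K_i` with no `P_ii` subtracted. -/
theorem followerMap_eq_Lff_mulVec (h : F.IsTarget pl ps) (x : Fin nf → Pt d) (i : Fin nf)
    (k : Fin d) : F.followerMap x i k = (F.Lff *ᵥ fun a => x a.1 a.2) (i, k) := by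
  classical
  have e1 : (F.Lff *ᵥ fun a => x a.1 a.2) (i, k) =
      ∑ j, act (F.lapBlock (Sum.inr i) (Sum.inr j)) (x j) k := by
    simp only [Matrix.mulVec, dotProduct, Fintype.sum_prod_type, Lff, laplacian, act]
    rfl
  have e2 : F.followerMap x i = ∑ j, act (F.lapBlock (Sum.inr i) (Sum.inr j)) (x j) := by
    rw [followerMap_apply, followerRows_apply']
    have : ∀ j, act (F.lapBlock (Sum.inr i) (Sum.inr j)) (x j) =
        (if i = j then act (F.K (Sum.inr i)) (x j) else 0) -
        (if F.graph.Adj (Sum.inr i) (Sum.inr j) then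
          act (F.P (Sum.inr i) (Sum.inr j)) (x j) else 0) := by
      intro j
      by_cases hij : i = j
      · subst hij
        simp [lapBlock, h.not_adj_self]
      · by_cases ha : F.graph.Adj (Sum.inr i) (Sum.inr j)
        · simp [lapBlock, hij, ha, act_neg]
        · simp [lapBlock, hij, ha, act_zero]
    simp only [this]
    rw [Finset.sum_sub_distrib, Finset.sum_ite_eq, if_pos (Finset.mem_univ _)]
    congr 1
    rw [nbrs, Finset.sum_filter, Fintype.sum_sum_type]
    have h0 : ∀ j : Fin nl, act (F.P (Sum.inr i) (Sum.inl j)) (0 : Pt d) = 0 :=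
      fun j => (actL _).map_zero
    simp [join, h0]
  rw [e1, e2]
  simp

theorem followerMap_injective (h : F.IsTarget pl ps) (hL : IsUnit F.Lff) :
    Function.Injective F.followerMap := by
  rw [← LinearMap.ker_eq_bot, LinearMap.ker_eq_bot']
  intro x hx
  have h1 : F.Lff *ᵥ (fun a => x a.1 a.2) = F.Lff *ᵥ 0 := by
    rw [Matrix.mulVec_zero]
    ext ⟨i, k⟩
    rw [← h.followerMap_eq_Lff_mulVec, hx]
    rfl
  have h2 := Matrix.mulVec_injective_of_isUnit hL h1
  ext i k
  exact congrFun h2 (i, k)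

/-- If `K_i u = 0`, then `∑ ‖P_ij u‖² = ⟨u, K_i u⟩ = 0`, so every `P_ij` kills `u`. The vector with
`u` at `i` and zero elsewhere is then in the kernel of `L_ff`: another row `m` meets `u` only
through `P_mi`, which equals `P_im` because follower edges are bidirectional. Hence `u = 0`. -/
theorem isUnit_K (h : F.IsTarget pl ps) (hL : IsUnit F.Lff) (i : Fin nf) :
    IsUnit (F.K (Sum.inr i)) := by
  classical
  rw [← Matrix.mulVec_injective_iff_isUnit]
  have key : ∀ u : Pt d, act (F.K (Sum.inr i)) u = 0 → u = 0 := by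
    intro u hu
    have hP : ∀ j ∈ F.nbrs (Sum.inr i), act (F.P (Sum.inr i) j) u = 0 := by
      have h1 : ∑ j ∈ F.nbrs (Sum.inr i), ‖act (F.P (Sum.inr i) j) u‖ ^ 2 = 0 := by
        have h2 : inner ℝ u (act (F.K (Sum.inr i)) u) = 0 := by rw [hu, inner_zero_right]
        rw [K, act_sum, inner_sum] at h2
        rw [← h2]
        exact Finset.sum_congr rfl fun j hj =>
          (inner_act_projMat (F.norm_bearing _ _ (F.mem_nbrs.1 hj)) u).symm
      intro j hj
      have h3 := (Finset.sum_eq_zero_iff_of_nonneg fun j _ => sq_nonneg _).1 h1 j hj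
      simpa using h3
    have hM : F.followerMap (Pi.single i u) = 0 := by
      ext1 m
      rw [followerMap_apply, followerRows_apply]
      refine Finset.sum_eq_zero fun j hj => ?_
      have hj' := F.mem_nbrs.1 hj
      by_cases hm : m = i
      · subst hm
        rcases j with j | j
        · simpa [join] using hP _ hj
        · have : j ≠ m := by
            rintro rfl
            exact h.not_adj_self _ hj'
          simpa [join, this] using hP _ hj
      · rcases j with j | j
        · simpa [join, hm] using (actL _).map_zero
        · by_cases hji : j = i
          · subst hji
            have hb := F.bidirectional _ _ hj'
            have h1 := hP _ (F.mem_nbrs.2 hb)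
            have h2 : act (F.P (Sum.inr m) (Sum.inr j)) (-u) = 0 := by
              rw [h.P_symm hj' hb, ← actL_apply, map_neg, actL_apply, h1, neg_zero]
            simpa [join, hm] using h2
          · simpa [join, hm, hji] using (actL _).map_zero
    have h2 : Pi.single (M := fun _ => Pt d) i u = 0 :=
      h.followerMap_injective hL (hM.trans (map_zero _).symm)
    simpa using congrFun h2 i
  intro u v huv
  have h1 := key (WithLp.toLp 2 (u - v)) (by
    simp only [act, Matrix.mulVec_sub, huv, sub_self, WithLp.toLp_zero])
  have h2 : u - v = 0 := (WithLp.toLp_eq_zero 2).1 h1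
  exact sub_eq_zero.1 h2

/-- Multiply by the invertible `K_i` and move the neighbours' accelerations to the left. -/
theorem control_eq_iff (h : F.IsTarget pl ps) (hL : IsUnit F.Lff) (sat : ℝ → ℝ) (kp kv : ℝ)
    (p v a : Agent nl nf → Pt d) (i : Fin nf) :
    a (Sum.inr i) = F.control sat kp kv p v a (Sum.inr i) ↔
      F.followerRows a i =
        mapVec sat (-(kp • F.followerRows p i + kv • F.followerRows v i)) := by
  have hK := (Matrix.isUnit_iff_isUnit_det _).1 (h.isUnit_K hL i)
  have e : ∑ j ∈ F.nbrs (Sum.inr i), act (F.P (Sum.inr i) j)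
      (kp • (p (Sum.inr i) - p j) + kv • (v (Sum.inr i) - v j)) =
      kp • F.followerRows p i + kv • F.followerRows v i := by
    rw [followerRows_apply, followerRows_apply, Finset.smul_sum, Finset.smul_sum,
      ← Finset.sum_add_distrib]
    refine Finset.sum_congr rfl fun j _ => ?_
    simp only [← actL_apply, map_add, map_smul]
  rw [control, e, followerRows_apply' F a, sub_eq_iff_eq_add, ← actL_apply (F.K _)⁻¹,
    ← actL_apply (F.K _)⁻¹, ← map_add, actL_apply]
  constructor
  · intro h1
    rw [h1, ← act_mul, Matrix.mul_nonsing_inv _ hK, act_one]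
  · intro h1
    rw [← h1, ← act_mul, Matrix.nonsing_inv_mul _ hK, act_one]

end IsTarget

end Setup

/-! ### Error coordinates and the closed loop -/

theorem PiecewiseC1.exists_locFinite_hasDerivWithinAt {E : Type*} [NormedAddCommGroup E]
    [NormedSpace ℝ E] {f : ℝ → E} (hf : PiecewiseC1 f) :
    ∃ D : Set ℝ, LocFinite D ∧ ∀ t, 0 ≤ t → t ∉ D → ∃ a, HasDerivWithinAt f a (Ici 0) t := by
  obtain ⟨-, S, hS, hC⟩ := hf
  -- Time `0` is excluded as well, so that `t` is interior to an interval free of break points.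
  refine ⟨insert 0 S, fun T => ?_, fun t ht htD => ?_⟩
  · refine ((hS T).insert 0).subset ?_
    rintro x ⟨rfl | hx, hxT⟩
    · exact mem_insert _ _
    · exact mem_insert_of_mem _ ⟨hx, hxT⟩
  · rw [mem_insert_iff, not_or] at htD
    have ht0 : 0 < t := lt_of_le_of_ne ht (Ne.symm htD.1)
    have hnhds : (S ∩ Icc 0 (t + 1))ᶜ ∩ Ioo 0 (t + 1) ∈ 𝓝 t :=
      inter_mem ((hS (t + 1)).isClosed.isOpen_compl.mem_nhds fun h => htD.2 h.1)
        (Ioo_mem_nhds ht0 (by linarith))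
    obtain ⟨a, b, ⟨hat, htb⟩, hab⟩ := mem_nhds_iff_exists_Ioo_subset.1 hnhds
    have ha : 0 ≤ a := by
      by_contra! ha
      exact lt_irrefl (0 : ℝ) (hab ⟨ha, ht0.trans htb⟩).2.1
    have hdisj : Disjoint (Ioo a b) S := by
      rw [Set.disjoint_left]
      intro x hx hxS
      exact (hab hx).1 ⟨hxS, Ioo_subset_Icc_self (hab hx).2⟩
    have h1 := ((hC a b ha (hat.trans htb) hdisj).differentiableOn one_ne_zero).differentiableAt
      (Icc_mem_nhds hat htb)
    exact ⟨_, h1.hasDerivAt.hasDerivWithinAt⟩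

namespace Setup.IsTarget

variable {F : Setup nl nf d} {pl vl : ℝ → Fin nl → Pt d} {ps : ℝ → Agent nl nf → Pt d}

/-- The target positions of the followers depend linearly on the leaders, and in the coordinates
given by the follower-follower block of the bearing Laplacian the follower rows only see the
deviation from the target. -/
theorem exists_error_coordinates (h : F.IsTarget pl ps) (hL : IsUnit F.Lff) :
    ∃ (Ψ : (Fin nf → Pt d) ≃L[ℝ] (Fin nf → Fin d → ℝ)) (T : (Fin nl → Pt d) →L[ℝ] (Fin nf → Pt d)),
      (∀ zl zf i k, F.followerRows (join zl zf) i k = Ψ (zf - T zl) i k) ∧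
      ∀ t, 0 ≤ t → followers ps t = T (pl t) := by
  set M := LinearEquiv.ofInjectiveEndo F.followerMap (h.followerMap_injective hL) with hM
  have hMa : ∀ x, M x = F.followerMap x := fun x => rfl
  -- `T = -L_ff⁻¹ L_fl`.
  set T : (Fin nl → Pt d) →ₗ[ℝ] (Fin nf → Pt d) := -(M.symm.toLinearMap ∘ₗ
    F.followerRows ∘ₗ joinL ∘ₗ LinearMap.inl ℝ (Fin nl → Pt d) (Fin nf → Pt d)) with hT
  have hT1 : ∀ zl, F.followerMap (T zl) = -F.followerRows (join zl 0) := by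
    intro zl
    rw [← hMa, hT, LinearMap.neg_apply, map_neg]
    exact congrArg Neg.neg (M.apply_symm_apply _)
  have hrows : ∀ zl zf, F.followerRows (join zl zf) = F.followerMap (zf - T zl) := by
    intro zl zf
    have h1 := F.followerRows_join_sub zl zf 0
    rw [sub_zero] at h1
    rw [map_sub, hT1, ← h1]
    abel
  refine ⟨M.toContinuousLinearEquiv.trans
    (ContinuousLinearEquiv.piCongrRight fun _ => EuclideanSpace.equiv (Fin d) ℝ),
    LinearMap.toContinuousLinearMap T, fun zl zf i k => ?_, fun t ht => ?_⟩
  · rw [hrows]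
    rfl
  · have h1 := h.followerRows_eq_zero ht
    rw [h.eq_join ht, hrows] at h1
    exact sub_eq_zero.1 (h.followerMap_injective hL (h1.trans (map_zero _).symm))

/-- In the coordinates `Ψ` the coupled implicit law splits into independent scalar equations. -/
theorem law_iff (h : F.IsTarget pl ps) (hL : IsUnit F.Lff) (sat : ℝ → ℝ) (kp kv : ℝ)
    {Ψ : (Fin nf → Pt d) ≃L[ℝ] (Fin nf → Fin d → ℝ)} {T : (Fin nl → Pt d) →L[ℝ] (Fin nf → Pt d)}
    (hΨ : ∀ zl zf i k, F.followerRows (join zl zf) i k = Ψ (zf - T zl) i k)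
    (xl ul al : Fin nl → Pt d) (xf uf af : Fin nf → Pt d) :
    (∀ i, af i = F.control sat kp kv (join xl xf) (join ul uf) (join al af) (Sum.inr i)) ↔
      ∀ i k, Ψ (af - T al) i k =
        sat (-(kp * Ψ (xf - T xl) i k + kv * Ψ (uf - T ul) i k)) := by
  refine forall_congr' fun i => ?_
  have h1 := h.control_eq_iff hL sat kp kv (join xl xf) (join ul uf) (join al af) i
  refine h1.trans ⟨fun h2 k => ?_, fun h2 => ?_⟩
  · rw [← hΨ, h2, ← hΨ, ← hΨ]
    rfl
  · ext k
    rw [hΨ, h2, ← hΨ, ← hΨ]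
    rfl

/-- In error coordinates the components of a trajectory are saturated double integrators. -/
theorem isSaturatedSolution (h : F.IsTarget pl ps) (hL : IsUnit F.Lff)
    (hlead : IsLeaderMotion pl vl) {sat : ℝ → ℝ} {c kp kv : ℝ} {K : NNReal}
    (hsat : SaturationLike sat c K)
    {Ψ : (Fin nf → Pt d) ≃L[ℝ] (Fin nf → Fin d → ℝ)} {T : (Fin nl → Pt d) →L[ℝ] (Fin nf → Pt d)}
    (hΨ : ∀ zl zf i k, F.followerRows (join zl zf) i k = Ψ (zf - T zl) i k)
    {pf vf : ℝ → Fin nf → Pt d} (htraj : F.IsTrajectory sat kp kv pl vl pf vf)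
    (i : Fin nf) (k : Fin d) :
    IsSaturatedSolution sat kp kv (fun t => Ψ (pf t - T (pl t)) i k)
      (fun t => Ψ (vf t - T (vl t)) i k) := by
  have hder : ∀ {xl : ℝ → Fin nl → Pt d} {xf : ℝ → Fin nf → Pt d} {yl yf t},
      HasDerivWithinAt xl yl (Ici 0) t → HasDerivWithinAt xf yf (Ici 0) t →
      HasDerivWithinAt (fun t => Ψ (xf t - T (xl t)) i k) (Ψ (yf - T yl) i k) (Ici 0) t := by
    intro xl xf yl yf t hl hf
    have h1 := hf.sub (T.hasFDerivAt.comp_hasDerivWithinAt t hl)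
    have h2 := Ψ.toContinuousLinearMap.hasFDerivAt.comp_hasDerivWithinAt t h1
    exact hasDerivWithinAt_pi.1 (hasDerivWithinAt_pi.1 h2 i) k
  have hpos : ∀ t, 0 ≤ t → HasDerivWithinAt (fun t => Ψ (pf t - T (pl t)) i k)
      (Ψ (vf t - T (vl t)) i k) (Ici 0) t := fun t ht =>
    hder (hlead.velocity t ht) (htraj.position t ht)
  have hvc : ContinuousOn (fun t => Ψ (vf t - T (vl t)) i k) (Ici 0) := by
    have h1 := Ψ.continuous.comp_continuousOn
      (htraj.continuous.sub (T.continuous.comp_continuousOn hlead.piecewise.1))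
    exact continuousOn_pi.1 (continuousOn_pi.1 h1 i) k
  have hpc : ContinuousOn (fun t => Ψ (pf t - T (pl t)) i k) (Ici 0) :=
    fun t ht => (hpos t ht).continuousWithinAt
  obtain ⟨D, hD, hlaw⟩ := htraj.law
  -- `v_f` may have kinks where the leaders' velocities do, but the velocity error has a continuous
  -- derivative throughout.
  refine ⟨hpos, hasDerivWithinAt_of_locFinite hD hvc ?_ fun t ht htD => ?_⟩
  · exact (hsat.continuous.comp_continuousOn
      ((continuousOn_const.mul hpc).add (continuousOn_const.mul hvc))).neg
  · obtain ⟨al, af, hal, haf, hu⟩ := hlaw t ht htD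
    have h1 := (h.law_iff hL sat kp kv hΨ _ _ _ _ _ _).1 hu i k
    rw [hsat.odd] at h1
    exact (hder hal haf).congr_deriv h1

/-- Every family of saturated double integrators comes from a trajectory of the followers. -/
theorem isTrajectory (h : F.IsTarget pl ps) (hL : IsUnit F.Lff)
    (hlead : IsLeaderMotion pl vl) {sat : ℝ → ℝ} {c kp kv : ℝ} {K : NNReal}
    (hsat : SaturationLike sat c K)
    {Ψ : (Fin nf → Pt d) ≃L[ℝ] (Fin nf → Fin d → ℝ)} {T : (Fin nl → Pt d) →L[ℝ] (Fin nf → Pt d)}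
    (hΨ : ∀ zl zf i k, F.followerRows (join zl zf) i k = Ψ (zf - T zl) i k)
    {q w : Fin nf → Fin d → ℝ → ℝ} (hqw : ∀ i k, IsSaturatedSolution sat kp kv (q i k) (w i k)) :
    F.IsTrajectory sat kp kv pl vl (fun t => T (pl t) + Ψ.symm fun i k => q i k t)
      (fun t => T (vl t) + Ψ.symm fun i k => w i k t) := by
  have hder : ∀ {xl : ℝ → Fin nl → Pt d} {x : Fin nf → Fin d → ℝ → ℝ} {yl t}
      {y : Fin nf → Fin d → ℝ}, HasDerivWithinAt xl yl (Ici 0) t →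
      (∀ i k, HasDerivWithinAt (x i k) (y i k) (Ici 0) t) →
      HasDerivWithinAt (fun t => T (xl t) + Ψ.symm fun i k => x i k t) (T yl + Ψ.symm y)
        (Ici 0) t := by
    intro xl x yl t y hl hx
    have h1 : HasDerivWithinAt (fun t i k => x i k t) y (Ici 0) t :=
      hasDerivWithinAt_pi.2 fun i => hasDerivWithinAt_pi.2 fun k => hx i k
    exact (T.hasFDerivAt.comp_hasDerivWithinAt t hl).add
      (Ψ.symm.toContinuousLinearMap.hasFDerivAt.comp_hasDerivWithinAt t h1)
  refine ⟨fun t ht => hder (hlead.velocity t ht) fun i k => (hqw i k).position t ht, ?_, ?_⟩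
  · have h1 : ContinuousOn (fun t i k => w i k t) (Ici 0) :=
      continuousOn_pi.2 fun i => continuousOn_pi.2 fun k t ht =>
        ((hqw i k).velocity t ht).continuousWithinAt
    exact (T.continuous.comp_continuousOn hlead.piecewise.1).add
      (Ψ.symm.continuous.comp_continuousOn h1)
  · obtain ⟨D, hD, hvl⟩ := hlead.piecewise.exists_locFinite_hasDerivWithinAt
    refine ⟨D, hD, fun t ht htD => ?_⟩
    obtain ⟨al, hal⟩ := hvl t ht htD
    refine ⟨al, _, hal, hder hal fun i k => (hqw i k).velocity t ht, ?_⟩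
    rw [h.law_iff hL sat kp kv hΨ]
    intro i k
    simp only [add_sub_cancel_left, ContinuousLinearEquiv.apply_symm_apply, hsat.odd]

end Setup.IsTarget

end BearingFormation

end

/-! ### Transfer to the tracking errors -/

open BearingFormation in
theorem theorem8 (nl nf d : ℕ) (_hd : 2 ≤ d) (_hnl : 2 ≤ nl) (F : Setup nl nf d)
    (hL : IsUnit F.Lff)
    (β kp kv : ℝ) (hβ : 0 < β) (hkp : 0 < kp) (hkv : 0 < kv)
    (sat : ℝ → ℝ) (hsat : IsSaturation β sat)
    (pl vl : ℝ → Fin nl → Pt d) (hlead : IsLeaderMotion pl vl)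
    (ps : ℝ → Agent nl nf → Pt d) (hps : F.IsTarget pl ps) :
    -- the followers of the target formation have a velocity, so that the velocity error makes sense
    (∀ t, 0 ≤ t → DifferentiableWithinAt ℝ (followers ps) (Ici 0) t) ∧
    -- the law can be followed on all of `[0, ∞)` from every initial condition
    (∀ p₀ v₀ : Fin nf → Pt d, ∃ pf vf : ℝ → Fin nf → Pt d,
      F.IsTrajectory sat kp kv pl vl pf vf ∧ pf 0 = p₀ ∧ vf 0 = v₀) ∧
    -- along every trajectory the errors converge to zero
    (∀ pf vf : ℝ → Fin nf → Pt d, F.IsTrajectory sat kp kv pl vl pf vf →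
      Tendsto (posError ps pf) atTop (𝓝 0) ∧ Tendsto (velError ps vf) atTop (𝓝 0)) ∧
    -- the zero error is stable
    (∀ ε : ℝ, 0 < ε → ∃ η : ℝ, 0 < η ∧
      ∀ pf vf : ℝ → Fin nf → Pt d, F.IsTrajectory sat kp kv pl vl pf vf →
        ‖posError ps pf 0‖ < η → ‖velError ps vf 0‖ < η →
        ∀ t, 0 ≤ t → ‖posError ps pf t‖ < ε ∧ ‖velError ps vf t‖ < ε) := by
  obtain ⟨c, K, hφ⟩ := hsat.saturationLike hβ
  obtain ⟨Ψ, T, hΨ, hT⟩ := hps.exists_error_coordinates hL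
  have hder : ∀ t, 0 ≤ t → HasDerivWithinAt (followers ps) (T (vl t)) (Ici 0) t := fun t ht =>
    (T.hasFDerivAt.comp_hasDerivWithinAt t (hlead.velocity t ht)).congr hT (hT t ht)
  have hpe : ∀ pf t, 0 ≤ t → posError ps pf t = pf t - T (pl t) := fun pf t ht => by
    rw [posError, hT t ht]
  have hve : ∀ vf t, 0 ≤ t → velError ps vf t = vf t - T (vl t) := fun vf t ht => by
    rw [velError, (hder t ht).derivWithin (uniqueDiffOn_Ici 0 t ht)]
  refine ⟨fun t ht => (hder t ht).differentiableWithinAt, fun p₀ v₀ => ?_, fun pf vf htraj => ?_,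
    fun ε hε => ?_⟩
  · choose q w hqw hq hw using fun i k => exists_saturatedSolution hφ kp kv
      (Ψ (p₀ - T (pl 0)) i k) (Ψ (v₀ - T (vl 0)) i k)
    refine ⟨_, _, hps.isTrajectory hL hlead hφ hΨ hqw, ?_, ?_⟩
    · simp only [hq]
      exact (congrArg (T (pl 0) + ·) (Ψ.symm_apply_apply _)).trans (add_sub_cancel _ _)
    · simp only [hw]
      exact (congrArg (T (vl 0) + ·) (Ψ.symm_apply_apply _)).trans (add_sub_cancel _ _)
  · have hsol := hps.isSaturatedSolution hL hlead hφ hΨ htraj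
    have key : ∀ x : ℝ → Fin nf → Pt d, (∀ i k, Tendsto (fun t => Ψ (x t) i k) atTop (𝓝 0)) →
        Tendsto x atTop (𝓝 0) := by
      intro x hx
      have h1 : Tendsto (fun t => Ψ (x t)) atTop (𝓝 0) :=
        tendsto_pi_nhds.2 fun i => tendsto_pi_nhds.2 fun k => hx i k
      simpa [Function.comp_def] using (Ψ.symm.continuous.tendsto 0).comp h1
    constructor
    · refine (key _ fun i k => ((hsol i k).tendsto_zero hφ hkp hkv).1).congr' ?_
      filter_upwards [eventually_ge_atTop 0] with t ht
      rw [hpe pf t ht]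
    · refine (key _ fun i k => ((hsol i k).tendsto_zero hφ hkp hkv).2).congr' ?_
      filter_upwards [eventually_ge_atTop 0] with t ht
      rw [hve vf t ht]
  · obtain ⟨ρ, hρ, hback⟩ := Metric.continuous_iff.1 Ψ.symm.continuous 0 ε hε
    simp only [dist_zero_right, map_zero] at hback
    obtain ⟨σ, hσ, hstab⟩ := saturated_stable hφ hkp hkv hρ
    obtain ⟨η, hη, hforth⟩ := Metric.continuous_iff.1 Ψ.continuous 0 σ hσ
    simp only [dist_zero_right, map_zero] at hforth
    refine ⟨η, hη, fun pf vf htraj hp hv t ht => ?_⟩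
    have hsol := hps.isSaturatedSolution hL hlead hφ hΨ htraj
    have hcomp : ∀ x : Fin nf → Pt d, ‖x‖ < η → ∀ i k, |Ψ x i k| < σ := fun x hx i k =>
      ((norm_le_pi_norm (Ψ x i) k).trans (norm_le_pi_norm (Ψ x) i)).trans_lt (hforth x hx)
    have hnorm : ∀ x : Fin nf → Pt d, (∀ i k, |Ψ x i k| < ρ) → ‖x‖ < ε := by
      intro x hx
      have h1 : ‖Ψ x‖ < ρ := (pi_norm_lt_iff hρ).2 fun i => (pi_norm_lt_iff hρ).2 (hx i)
      simpa using hback _ h1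
    rw [hpe pf 0 le_rfl] at hp
    rw [hve vf 0 le_rfl] at hv
    have hall := fun i k => hstab _ _ (hsol i k) (hcomp _ hp i k) (hcomp _ hv i k) t ht
    rw [hpe pf t ht, hve vf t ht]
    exact ⟨hnorm _ fun i k => (hall i k).1, hnorm _ fun i k => (hall i k).2⟩
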